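/- Let $f:\mathbb R^n\to\mathbb R$, $g=(g_1,\dots,g_m):\mathbb R^n\to\mathbb R^m$ and $G:\mathbb R^n\to\mathbb S^d$ be twice continuously differentiable, where $\mathbb S^d$ is the space of real symmetric $d\times d$ matrices with inner product $\langle V,W\rangle=\operatorname{tr}(V^\top W)$ and the Frobenius norm. For $X\in\mathbb S^d$ with an orthogonal diagonalization $X=P\,\mathrm{diag}(\lambda_1,\dots,\lambda_d)P^\top$ put $[X]_+=P\,\mathrm{diag}(\max\{\lambda_1,0\},\dots,\max\{\lambda_d,0\})P^\top$ (independent of the choice of $P$), and let $\mathcal Q:\mathbb S^d\to\mathbb S^d$, $\mathcal Q(X)=[X]_+^3$. (a) $\mathcal Q$ is differentiable on $\mathbb S^d$, and its derivative $X\mapsto D\mathcal Q(X)$ is continuous. Moreover $D\mathcal Q(O)=0$, and if $X\ne O$ is written as $$X=\begin{bmatrix}P_I&P_J\end{bmatrix}\begin{bmatrix}\Lambda&O\\O&O\end{bmatrix}\begin{bmatrix}P_I^\top\\P_J^\top\end{bmatrix},\qquad \Lambda=\mathrm{diag}(\mu_1,\dots,\mu_\ell),\quad \mu_j\neq0\ (j=1,\dots,\ell),$$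 with $[P_I\ P_J]$ an orthogonal $d\times d$ matrix, $P_I\in\mathbb R^{d\times\ell}$, $P_J\in\mathbb R^{d\times(d-\ell)}$ (the blocks involving $P_J$ being absent if $X$ is nonsingular), then for all $H\in\mathbb S^d$ $$D\mathcal Q(X)H=\begin{bmatrix}P_I&P_J\end{bmatrix}\begin{bmatrix}A\circ(P_I^\top HP_I)&B\,P_I^\top HP_J\\P_J^\top HP_I\,B&O\end{bmatrix}\begin{bmatrix}P_I^\top\\P_J^\top\end{bmatrix},$$ where $\circ$ is the entrywise product and $$A_{ij}=\frac{(|\mu_i|^3+\mu_i^3+|\mu_j|^3+\mu_j^3)(\mu_i^2+\mu_i\mu_j+\mu_j^2)}{2(|\mu_i|^3+|\mu_j|^3)},\qquad B=\tfrac12(|\Lambda|+\Lambda)\Lambda,\qquad |\Lambda|=\mathrm{diag}(|\mu_1|,\dots,|\mu_\ell|).$$ (b) Let $v\in\mathbb R^m$, $M\in\mathbb S^d$, $\rho,\sigma,\tau>0$, and $$F(x)=\rho f(x)+\frac{\sigma\tau}2\Big\|\frac1\tau v-g(x)\Big\|^2+\frac{\sigma\tau}4\operatorname{tr}\Big(\Big[\frac1\tau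 M-G(x)\Big]_+^4\Big).$$ Then $F$ is twice continuously differentiable on $\mathbb R^n$. With $\nabla g(x)=[\nabla g_1(x)\ \cdots\ \nabla g_m(x)]\in\mathbb R^{n\times m}$, $G_i=\partial G/\partial x_i$, $G_{ij}=\partial_{x_i}(\partial_{x_j}G)$ and $DG(x)^*$ the adjoint of $DG(x):\mathbb R^n\to\mathbb S^d$, one has for every $x\in\mathbb R^n$ $$\nabla F(x)=\rho\nabla f(x)-\sigma\tau\,\nabla g(x)\Big(\frac1\tau v-g(x)\Big)-\sigma\tau\,DG(x)^*\Big[\frac1\tau M-G(x)\Big]_+^3,$$ $$\begin{aligned}\nabla^2F(x)={}&\rho\nabla^2f(x)-\sigma\tau\sum_{j=1}^m\Big(\frac1\tau v_j-g_j(x)\Big)\nabla^2g_j(x)+\sigma\tau\,\nabla g(x)\nabla g(x)^\top\\&-\sigma\tau\Big[\big\langle G_{ij}(x),[\tfrac1\tau M-G(x)]_+^3\big\rangle\Big]_{i,j=1}^n+\sigma\tau\Big[\big\langle G_i(x),D\mathcal Q(\tfrac1\tau M-G(x))\,G_j(x)\big\rangle\Big]_{i,j=1}^n.\end{aligned}$$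 -/

import Mathlib

open scoped Matrix ContDiff

/-! ### Symmetric matrices with the trace inner product -/

/-- The subspace of symmetric matrices. -/
def symSubmodule (d : ℕ) : Submodule ℝ (Matrix (Fin d) (Fin d) ℝ) where
  carrier := {A | A.IsSymm}
  add_mem' := fun ha hb => Matrix.IsSymm.add ha hb
  zero_mem' := Matrix.isSymm_zero
  smul_mem' := fun c _ ha => Matrix.IsSymm.smul ha c

/-- The space `𝕊ᵈ` of real symmetric `d × d` matrices. -/
def SymMat (d : ℕ) : Type := symSubmodule d

noncomputable instance (d : ℕ) : AddCommGroup (SymMat d) :=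
  inferInstanceAs (AddCommGroup (symSubmodule d))

noncomputable instance (d : ℕ) : Module ℝ (SymMat d) :=
  inferInstanceAs (Module ℝ (symSubmodule d))

/-- The inclusion of `𝕊ᵈ` into all `d × d` matrices. -/
noncomputable def SymMat.mat {d : ℕ} : SymMat d →ₗ[ℝ] Matrix (Fin d) (Fin d) ℝ :=
  (symSubmodule d).subtype

/-- A symmetric matrix as an element of `𝕊ᵈ`. -/
def SymMat.ofSymm {d : ℕ} (A : Matrix (Fin d) (Fin d) ℝ) (hA : A.IsSymm) : SymMat d := ⟨A, hA⟩

@[simp] theorem SymMat.mat_ofSymm {d : ℕ} (A : Matrix (Fin d) (Fin d) ℝ) (hA : A.IsSymm) :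
    (SymMat.ofSymm A hA).mat = A := rfl

theorem SymMat.isSymm {d : ℕ} (X : SymMat d) : X.mat.IsSymm := X.2

@[ext] theorem SymMat.ext {d : ℕ} {X Y : SymMat d} (h : X.mat = Y.mat) : X = Y := Subtype.ext h

/-- The inner product `⟨V, W⟩ = tr (Vᵀ W)` on `𝕊ᵈ`. -/
@[reducible] noncomputable def SymMat.innerCore (d : ℕ) : InnerProductSpace.Core ℝ (SymMat d) where
  inner V W := (V.matᵀ * W.mat).trace
  conj_inner_symm V W := by
    rw [← Matrix.trace_transpose (W.matᵀ * V.mat)]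
    simp [Matrix.transpose_mul]
  re_inner_nonneg V := by
    simp only [Matrix.trace, Matrix.diag_apply, Matrix.mul_apply, Matrix.transpose_apply,
      RCLike.re_to_real]
    exact Finset.sum_nonneg fun i _ => Finset.sum_nonneg fun j _ => mul_self_nonneg _
  add_left U V W := by
    simp [Matrix.transpose_add, Matrix.add_mul]
  smul_left V W r := by
    simp [Matrix.transpose_smul]
  definite V h := by
    have h' : ∑ i, ∑ j, V.mat j i * V.mat j i = 0 := by
      simpa [Matrix.trace, Matrix.mul_apply] using h
    rw [Finset.sum_eq_zero_iff_of_nonneg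
      (fun i _ => Finset.sum_nonneg fun j _ => mul_self_nonneg _)] at h'
    apply SymMat.ext
    ext j i
    have h2 := (Finset.sum_eq_zero_iff_of_nonneg (fun j _ => mul_self_nonneg _)).mp
      (h' i (Finset.mem_univ i)) j (Finset.mem_univ j)
    simpa using h2

/-- `𝕊ᵈ` is normed by the Frobenius norm `‖X‖ = √⟨X, X⟩`. -/
noncomputable instance (d : ℕ) : NormedAddCommGroup (SymMat d) :=
  (SymMat.innerCore d).toNormedAddCommGroup

noncomputable instance (d : ℕ) : InnerProductSpace ℝ (SymMat d) :=
  InnerProductSpace.ofCore (SymMat.innerCore d).toCore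

theorem SymMat.inner_def {d : ℕ} (V W : SymMat d) :
    inner ℝ V W = (V.matᵀ * W.mat).trace := rfl

instance (d : ℕ) : FiniteDimensional ℝ (SymMat d) :=
  inferInstanceAs (FiniteDimensional ℝ (symSubmodule d))

instance (d : ℕ) : CompleteSpace (SymMat d) := FiniteDimensional.complete ℝ (SymMat d)

theorem SymMat.isHermitian {d : ℕ} (X : SymMat d) :
    X.mat.IsHermitian := by
  have h : X.matᵀ = X.mat := X.2
  rw [Matrix.IsHermitian, Matrix.conjTranspose_eq_transpose_of_trivial, h]

/-! ### The positive part and its third power -/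

theorem isSymm_mul_diagonal_mul_transpose {d : ℕ} (P : Matrix (Fin d) (Fin d) ℝ)
    (w : Fin d → ℝ) : (P * Matrix.diagonal w * Pᵀ).IsSymm := by
  simp [Matrix.IsSymm, Matrix.transpose_mul, Matrix.mul_assoc]

/-- The positive part `[X]₊ = P diag([λ₁]₊, …, [λ_d]₊) Pᵀ`, written with one orthogonal
diagonalization `X = P diag(λ₁, …, λ_d) Pᵀ`. By `SymMat.posPart_eq` below, every orthogonal
diagonalization gives the same matrix. -/
noncomputable def SymMat.posPart {d : ℕ} (X : SymMat d) : SymMat d :=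
  SymMat.ofSymm
    (X.isHermitian.eigenvectorUnitary.val *
      Matrix.diagonal (fun i => max (X.isHermitian.eigenvalues i) 0) *
      X.isHermitian.eigenvectorUnitary.valᵀ)
    (isSymm_mul_diagonal_mul_transpose _ _)

theorem SymMat.posPart_eq {d : ℕ} (X : SymMat d) (P : Matrix (Fin d) (Fin d) ℝ)
    (μ : Fin d → ℝ) (hP : Pᵀ * P = 1)
    (hX : X.mat = P * Matrix.diagonal μ * Pᵀ) :
    X.posPart.mat =
      P * Matrix.diagonal (fun i => max (μ i) 0) * Pᵀ := by
  have hP' : P * Pᵀ = 1 := mul_eq_one_comm.mp hP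
  set U : Matrix (Fin d) (Fin d) ℝ :=
    X.isHermitian.eigenvectorUnitary.val with hU
  set l := X.isHermitian.eigenvalues with hl
  have hUU : Uᵀ * U = 1 := by
    have := Unitary.coe_star_mul_self X.isHermitian.eigenvectorUnitary
    rwa [Matrix.star_eq_conjTranspose, Matrix.conjTranspose_eq_transpose_of_trivial] at this
  have hUU' : U * Uᵀ = 1 := mul_eq_one_comm.mp hUU
  have hXU : X.mat = U * Matrix.diagonal l * Uᵀ := by
    have := X.isHermitian.spectral_theorem
    rw [Unitary.conjStarAlgAut_apply, Matrix.star_eq_conjTranspose,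
      Matrix.conjTranspose_eq_transpose_of_trivial] at this
    exact this
  have key : Matrix.diagonal l * (Uᵀ * P) = (Uᵀ * P) * Matrix.diagonal μ := by
    calc Matrix.diagonal l * (Uᵀ * P)
        = (Uᵀ * U) * Matrix.diagonal l * Uᵀ * P := by rw [hUU]; simp [Matrix.mul_assoc]
      _ = Uᵀ * (U * Matrix.diagonal l * Uᵀ) * P := by simp only [Matrix.mul_assoc]
      _ = Uᵀ * (P * Matrix.diagonal μ * Pᵀ) * P := by rw [← hXU, hX]
      _ = Uᵀ * P * Matrix.diagonal μ * (Pᵀ * P) := by simp only [Matrix.mul_assoc]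
      _ = (Uᵀ * P) * Matrix.diagonal μ := by rw [hP, Matrix.mul_one]
  have key2 : Matrix.diagonal (fun i => max (l i) 0) * (Uᵀ * P) =
      (Uᵀ * P) * Matrix.diagonal (fun i => max (μ i) 0) := by
    ext i j
    have h := congrFun (congrFun key i) j
    rw [Matrix.diagonal_mul, Matrix.mul_diagonal] at h ⊢
    by_cases h0 : (Uᵀ * P) i j = 0
    · rw [h0]; simp
    · have : l i = μ j := mul_left_cancel₀ h0 (by rw [← h, mul_comm])
      rw [this, mul_comm]
  calc X.posPart.mat
      = U * Matrix.diagonal (fun i => max (l i) 0) * Uᵀ := rfl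
    _ = U * Matrix.diagonal (fun i => max (l i) 0) * Uᵀ * (P * Pᵀ) := by
        rw [hP', Matrix.mul_one]
    _ = U * (Matrix.diagonal (fun i => max (l i) 0) * (Uᵀ * P)) * Pᵀ := by
        simp only [Matrix.mul_assoc]
    _ = (U * Uᵀ) * P * Matrix.diagonal (fun i => max (μ i) 0) * Pᵀ := by
        rw [key2]; simp only [Matrix.mul_assoc]
    _ = P * Matrix.diagonal (fun i => max (μ i) 0) * Pᵀ := by rw [hUU', Matrix.one_mul]

/-- The map `𝒬(X) = [X]₊³` on `𝕊ᵈ`. -/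
noncomputable def cubePosPart {d : ℕ} (X : SymMat d) : SymMat d :=
  SymMat.ofSymm (X.posPart.mat ^ 3) (Matrix.IsSymm.pow X.posPart.isSymm 3)

/-- `A i j = (|μᵢ|³ + μᵢ³ + |μⱼ|³ + μⱼ³)(μᵢ² + μᵢ μⱼ + μⱼ²) / (2 (|μᵢ|³ + |μⱼ|³))`. -/
noncomputable def coeffA {l : ℕ} (μ : Fin l → ℝ) : Matrix (Fin l) (Fin l) ℝ :=
  Matrix.of fun i j =>
    ((|μ i| ^ 3 + μ i ^ 3 + |μ j| ^ 3 + μ j ^ 3) * (μ i ^ 2 + μ i * μ j + μ j ^ 2)) /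
      (2 * (|μ i| ^ 3 + |μ j| ^ 3))

/-- `B = ½ (|Λ| + Λ) Λ` with `Λ = diag(μ₁, …, μ_l)`. -/
noncomputable def coeffB {l : ℕ} (μ : Fin l → ℝ) : Matrix (Fin l) (Fin l) ℝ :=
  (1 / 2 : ℝ) • ((Matrix.diagonal (fun i => |μ i|) + Matrix.diagonal μ) * Matrix.diagonal μ)

/-! ### Partial derivatives, Hessian, and the penalty function -/

/-- The partial derivative `∂φ/∂xᵢ` at `x`. -/
noncomputable def partialDeriv {n : ℕ} {Y : Type*} [NormedAddCommGroup Y] [NormedSpace ℝ Y]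
    (i : Fin n) (φ : EuclideanSpace ℝ (Fin n) → Y) (x : EuclideanSpace ℝ (Fin n)) : Y :=
  lineDeriv ℝ φ x (EuclideanSpace.single i 1)

/-- The Hessian matrix `∇²φ(x)`, with entries `∂/∂xᵢ (∂φ/∂xⱼ)`. -/
noncomputable def hessian {n : ℕ} (φ : EuclideanSpace ℝ (Fin n) → ℝ)
    (x : EuclideanSpace ℝ (Fin n)) : Matrix (Fin n) (Fin n) ℝ :=
  Matrix.of fun i j => partialDeriv i (partialDeriv j φ) x

/-- The `n × m` matrix `∇ψ(x) = [∇ψ₁(x) ⋯ ∇ψ_m(x)]` whose columns are the gradients of the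
components of `ψ`. -/
noncomputable def gradMatrix {n m : ℕ}
    (ψ : EuclideanSpace ℝ (Fin n) → EuclideanSpace ℝ (Fin m))
    (x : EuclideanSpace ℝ (Fin n)) : Matrix (Fin n) (Fin m) ℝ :=
  Matrix.of fun i j => gradient (fun y => ψ y j) x i

/-- The penalty function
`F(x; v, M, ρ, σ, τ) = ρ f(x) + (στ/2) ‖v/τ - g(x)‖² + (στ/4) tr([M/τ - G(x)]₊⁴)`. -/
noncomputable def penaltyF {n m d : ℕ} (f : EuclideanSpace ℝ (Fin n) → ℝ)
    (g : EuclideanSpace ℝ (Fin n) → EuclideanSpace ℝ (Fin m))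
    (G : EuclideanSpace ℝ (Fin n) → SymMat d)
    (v : EuclideanSpace ℝ (Fin m)) (M : SymMat d) (ρ σ τ : ℝ)
    (x : EuclideanSpace ℝ (Fin n)) : ℝ :=
  ρ * f x + σ * τ / 2 * ‖(1 / τ) • v - g x‖ ^ 2 +
    σ * τ / 4 *
      ((((1 / τ) • M - G x).posPart.mat) ^ 4).trace

/-!
For a `C¹` function `φ` on the line, the spectral function `φ(X) = P diag(φ(λᵢ)) Pᵀ` satisfies
`φ(Y) - φ(X) = T (Y - X)`, where `T = T_{X,Y}` multiplies the `(i, j)` entry of a matrix, taken in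
eigenbases of `X` and `Y`, by the divided difference of `φ` at the `i`-th eigenvalue of `X` and the
`j`-th eigenvalue of `Y`. Eigenbases cannot be chosen continuously, but `T` does not depend on the
choice, and `(P, λ) ↦ P diag(λ) Pᵀ` is a proper surjection because the orthogonal group is compact;
so `T` is continuous in `(X, Y)`. Hence `φ` is `C¹` with derivative `T_{X,X}`, and taking traces,
`X ↦ tr φ(X)` has gradient `φ'(X)`. With `φ(t) = max(t, 0)³` this gives (a). With
`φ(t) = max(t, 0)⁴ / 4` it shows that `¼ tr [X]₊⁴` has gradient `𝒬(X)`, and (b) is the chain rule.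
-/

open scoped Topology

/-! ### Divided differences -/

theorem hasFDerivAt_of_slope {𝕜 E F : Type*} [NontriviallyNormedField 𝕜]
    [NormedAddCommGroup E] [NormedSpace 𝕜 E] [NormedAddCommGroup F] [NormedSpace 𝕜 F]
    {f : E → F} {T : E → E →L[𝕜] F} {x : E} (hT : ContinuousAt T x)
    (h : ∀ y, f y - f x = T y (y - x)) : HasFDerivAt f (T x) x := by
  have hT0 : (fun y => T y - T x) =o[𝓝 x] fun _ => (1 : ℝ) :=
    (Asymptotics.isLittleO_one_iff ℝ).mpr (by simpa using hT.tendsto.sub_const (T x))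
  refine .of_isLittleO (Asymptotics.IsBigO.trans_isLittleO
    (g := fun y => ‖T y - T x‖ * ‖y - x‖) ?_ ?_)
  · refine .of_norm_le fun y => ?_
    rw [h, ← _root_.sub_apply]
    exact (T y - T x).le_opNorm _
  · simpa using hT0.norm_left.mul_isBigO (Asymptotics.isBigO_refl (fun y => ‖y - x‖) (𝓝 x))

section DividedDifference

variable {𝕜 E : Type*} [NontriviallyNormedField 𝕜] [NormedAddCommGroup E] [NormedSpace 𝕜 E]

theorem dslope_comm (f : 𝕜 → E) (a b : 𝕜) : dslope f a b = dslope f b a := by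
  obtain rfl | hab := eq_or_ne a b
  · rfl
  · rw [dslope_of_ne _ hab, dslope_of_ne _ hab.symm, slope_comm]

variable {F : Type*} [NormedAddCommGroup F] [NormedSpace ℝ F] [CompleteSpace F] {φ : ℝ → F}

theorem dslope_eq_integral_deriv (hφ : ContDiff ℝ 1 φ) (a b : ℝ) :
    dslope φ a b = ∫ t in (0 : ℝ)..1, deriv φ (a + t * (b - a)) := by
  obtain rfl | hab := eq_or_ne a b
  · simp
  · have hint := intervalIntegral.integral_unitInterval_deriv_eq_sub (z₀ := a) (z₁ := b - a)
      (f := φ) (f' := deriv φ) (hφ.continuous_deriv_one.comp (by fun_prop)).continuousOn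
      (fun t _ => (hφ.differentiable one_ne_zero _).hasDerivAt)
    refine smul_right_injective F (sub_ne_zero.mpr hab.symm) ?_
    simpa [sub_smul_dslope] using hint.symm

theorem continuous_dslope_uncurry (hφ : ContDiff ℝ 1 φ) :
    Continuous fun p : ℝ × ℝ => dslope φ p.1 p.2 := by
  simp only [dslope_eq_integral_deriv hφ]
  refine intervalIntegral.continuous_parametric_intervalIntegral_of_continuous' ?_ 0 1
  exact hφ.continuous_deriv_one.comp
    (by fun_prop : Continuous fun q : (ℝ × ℝ) × ℝ => q.1.1 + q.2 * (q.1.2 - q.1.1))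

end DividedDifference

/-! ### Schur multipliers in orthonormal eigenbases -/

/-- The orthogonal diagonalization `A = P diag(μ) Pᵀ`. The columns of `P` may be indexed by any
type, so that they can be grouped into blocks. -/
structure IsOrthDiag {R n ι : Type*} [CommRing R] [Fintype n] [DecidableEq n] [Fintype ι]
    [DecidableEq ι] (A : Matrix n n R) (P : Matrix n ι R) (μ : ι → R) : Prop where
  transpose_mul : Pᵀ * P = 1
  mul_transpose : P * Pᵀ = 1
  eq : A = P * Matrix.diagonal μ * Pᵀ

/-- The Schur multiplier with symbol `Φ`: in the bases given by the columns of `P` and `Q`, the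
`(i, j)` entry of a matrix is multiplied by `Φ (μ i) (ν j)`. -/
def schurMultiplier {R m n ι κ : Type*} [CommRing R] [Fintype m] [Fintype n] [Fintype ι]
    [Fintype κ] (Φ : R → R → R) (P : Matrix m ι R) (μ : ι → R) (Q : Matrix n κ R) (ν : κ → R) :
    Matrix m n R →ₗ[R] Matrix m n R where
  toFun K := P * (Matrix.of (fun i j => Φ (μ i) (ν j)) ⊙ (Pᵀ * K * Q)) * Qᵀ
  map_add' K L := by simp only [Matrix.mul_add, Matrix.add_mul, Matrix.hadamard_add]
  map_smul' c K := by
    simp only [Matrix.mul_smul, Matrix.smul_mul, Matrix.hadamard_smul, RingHom.id_apply]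

section SchurMultiplier

variable {R m n ι κ ι' κ' : Type*} [CommRing R] [Fintype m] [Fintype n] [Fintype ι] [Fintype κ]

theorem schurMultiplier_apply (Φ : R → R → R) (P : Matrix m ι R) (μ : ι → R) (Q : Matrix n κ R)
    (ν : κ → R) (K : Matrix m n R) :
    schurMultiplier Φ P μ Q ν K =
      P * (Matrix.of (fun i j => Φ (μ i) (ν j)) ⊙ (Pᵀ * K * Q)) * Qᵀ :=
  rfl

theorem transpose_schurMultiplier (Φ : R → R → R) (P : Matrix m ι R) (μ : ι → R)
    (Q : Matrix n κ R) (ν : κ → R) (K : Matrix m n R) :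
    (schurMultiplier Φ P μ Q ν K)ᵀ = schurMultiplier (flip Φ) Q ν P μ Kᵀ := by
  have hK : Qᵀ * Kᵀ * P = (Pᵀ * K * Q)ᵀ := by
    simp only [Matrix.transpose_mul, Matrix.transpose_transpose, Matrix.mul_assoc]
  rw [schurMultiplier_apply, schurMultiplier_apply, hK, Matrix.transpose_mul, Matrix.transpose_mul,
    Matrix.transpose_transpose, ← Matrix.mul_assoc]
  rfl

theorem continuous_schurMultiplier [TopologicalSpace R] [IsTopologicalRing R] {Z : Type*}
    [TopologicalSpace Z] {Φ : R → R → R} (hΦ : Continuous fun p : R × R => Φ p.1 p.2)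
    {P : Z → Matrix m ι R} {μ : Z → ι → R} {Q : Z → Matrix n κ R} {ν : Z → κ → R}
    (hP : Continuous P) (hμ : Continuous μ) (hQ : Continuous Q) (hν : Continuous ν)
    (K : Matrix m n R) : Continuous fun z => schurMultiplier Φ (P z) (μ z) (Q z) (ν z) K := by
  have hK : Continuous fun z => (P z)ᵀ * K * Q z := by fun_prop
  have hcore : Continuous fun z =>
      Matrix.of (fun i j => Φ (μ z i) (ν z j)) ⊙ ((P z)ᵀ * K * Q z) :=
    continuous_matrix fun i j => (hΦ.comp (((continuous_apply i).comp hμ).prodMk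
      ((continuous_apply j).comp hν))).mul (hK.matrix_elem i j)
  exact (hP.matrix_mul hcore).matrix_mul hQ.matrix_transpose

variable [DecidableEq m] [DecidableEq n] [DecidableEq ι] [DecidableEq κ] [Fintype ι']
  [DecidableEq ι'] [Fintype κ'] [DecidableEq κ'] {A : Matrix m m R} {C : Matrix n n R}
  {P : Matrix m ι R} {μ : ι → R} {P' : Matrix m ι' R} {μ' : ι' → R}
  {Q : Matrix n κ R} {ν : κ → R} {Q' : Matrix n κ' R} {ν' : κ' → R}

theorem IsOrthDiag.transpose_mul_mul (hA : IsOrthDiag A P μ) :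
    Pᵀ * A * P = Matrix.diagonal μ := by
  calc Pᵀ * A * P = Pᵀ * P * Matrix.diagonal μ * (Pᵀ * P) := by
        rw [hA.eq]
        simp only [Matrix.mul_assoc]
    _ = Matrix.diagonal μ := by rw [hA.transpose_mul, Matrix.one_mul, Matrix.mul_one]

theorem IsOrthDiag.transpose_mul_commutator_mul (hA : IsOrthDiag A P μ) (hC : IsOrthDiag C Q ν)
    (K : Matrix m n R) (i : ι) (j : κ) :
    (Pᵀ * (A * K - K * C) * Q) i j = (μ i - ν j) * (Pᵀ * K * Q) i j := by
  have h : Pᵀ * (A * K - K * C) * Q =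
      Matrix.diagonal μ * (Pᵀ * K * Q) - Pᵀ * K * Q * Matrix.diagonal ν := by
    calc Pᵀ * (A * K - K * C) * Q
        = Pᵀ * P * Matrix.diagonal μ * (Pᵀ * K * Q) -
            Pᵀ * K * Q * Matrix.diagonal ν * (Qᵀ * Q) := by
          rw [hA.eq, hC.eq]
          simp only [Matrix.mul_sub, Matrix.sub_mul, Matrix.mul_assoc]
      _ = _ := by rw [hA.transpose_mul, hC.transpose_mul, Matrix.one_mul, Matrix.mul_one]
  rw [h, Matrix.sub_apply, Matrix.mul_diagonal, Matrix.diagonal_mul]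
  ring

theorem schurMultiplier_commutator {Φ : R → R → R} {φ : R → R}
    (hΦ : ∀ a b, Φ a b * (a - b) = φ a - φ b) (hA : IsOrthDiag A P μ) (hC : IsOrthDiag C Q ν)
    {A' : Matrix m m R} {C' : Matrix n n R} (hA' : IsOrthDiag A' P (φ ∘ μ))
    (hC' : IsOrthDiag C' Q (φ ∘ ν)) (K : Matrix m n R) :
    schurMultiplier Φ P μ Q ν (A * K - K * C) = A' * K - K * C' := by
  have h : Matrix.of (fun i j => Φ (μ i) (ν j)) ⊙ (Pᵀ * (A * K - K * C) * Q) =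
      Pᵀ * (A' * K - K * C') * Q := by
    ext i j
    rw [hA'.transpose_mul_commutator_mul hC', Matrix.hadamard_apply,
      hA.transpose_mul_commutator_mul hC, Matrix.of_apply, ← mul_assoc, hΦ]
    rfl
  calc schurMultiplier Φ P μ Q ν (A * K - K * C)
      = P * (Pᵀ * (A' * K - K * C') * Q) * Qᵀ := by rw [schurMultiplier_apply, h]
    _ = P * Pᵀ * (A' * K - K * C') * (Q * Qᵀ) := by simp only [Matrix.mul_assoc]
    _ = A' * K - K * C' := by
      rw [hA.mul_transpose, hC.mul_transpose, Matrix.one_mul, Matrix.mul_one]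

variable [NoZeroDivisors R]

theorem IsOrthDiag.eq_of_ne_zero (hC : IsOrthDiag C Q ν) (hC' : IsOrthDiag C Q' ν') {i : κ}
    {j : κ'} (h : (Qᵀ * Q') i j ≠ 0) : ν i = ν' j := by
  have hcomm := hC.transpose_mul_commutator_mul hC' 1 i j
  rw [Matrix.mul_one, Matrix.one_mul, sub_self, Matrix.mul_zero, Matrix.zero_mul, Matrix.mul_one,
    Matrix.zero_apply, eq_comm, mul_eq_zero] at hcomm
  exact sub_eq_zero.mp (hcomm.resolve_right h)

omit [DecidableEq m] [DecidableEq ι] in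
theorem IsOrthDiag.schurMultiplier_right_eq (hC : IsOrthDiag C Q ν) (hC' : IsOrthDiag C Q' ν')
    (Φ : R → R → R) (P : Matrix m ι R) (μ : ι → R) :
    schurMultiplier Φ P μ Q ν = schurMultiplier Φ P μ Q' ν' := by
  refine LinearMap.ext fun K => ?_
  have hQ : Pᵀ * K * Q' = Pᵀ * K * Q * (Qᵀ * Q') := by
    rw [Matrix.mul_assoc (Pᵀ * K) Q, ← Matrix.mul_assoc Q, hC.mul_transpose, Matrix.one_mul]
  have h : Matrix.of (fun i j => Φ (μ i) (ν j)) ⊙ (Pᵀ * K * Q) * (Qᵀ * Q') =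
      Matrix.of (fun i j => Φ (μ i) (ν' j)) ⊙ (Pᵀ * K * Q') := by
    ext i j
    rw [hQ, Matrix.hadamard_apply, Matrix.mul_apply, Matrix.mul_apply (M := Pᵀ * K * Q),
      Finset.mul_sum]
    refine Finset.sum_congr rfl fun k _ => ?_
    by_cases hkj : (Qᵀ * Q') k j = 0
    · simp only [hkj, mul_zero]
    · simp only [Matrix.hadamard_apply, Matrix.of_apply, hC.eq_of_ne_zero hC' hkj, mul_assoc]
  calc schurMultiplier Φ P μ Q ν K
      = schurMultiplier Φ P μ Q ν K * (Q' * Q'ᵀ) := by rw [hC'.mul_transpose, Matrix.mul_one]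
    _ = P * (Matrix.of (fun i j => Φ (μ i) (ν j)) ⊙ (Pᵀ * K * Q) * (Qᵀ * Q')) * Q'ᵀ := by
      simp only [schurMultiplier_apply, Matrix.mul_assoc]
    _ = schurMultiplier Φ P μ Q' ν' K := by rw [h, schurMultiplier_apply]

theorem schurMultiplier_eq (hA : IsOrthDiag A P μ) (hA' : IsOrthDiag A P' μ')
    (hC : IsOrthDiag C Q ν) (hC' : IsOrthDiag C Q' ν') (Φ : R → R → R) :
    schurMultiplier Φ P μ Q ν = schurMultiplier Φ P' μ' Q' ν' := by
  refine (hC.schurMultiplier_right_eq hC' Φ P μ).trans (LinearMap.ext fun K => ?_)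
  rw [← Matrix.transpose_inj, transpose_schurMultiplier, transpose_schurMultiplier,
    hA.schurMultiplier_right_eq hA']

theorem IsOrthDiag.mul_diagonal_comp_mul_transpose_eq (hA : IsOrthDiag A P μ)
    (hA' : IsOrthDiag A P' μ') (φ : R → R) :
    P * Matrix.diagonal (φ ∘ μ) * Pᵀ = P' * Matrix.diagonal (φ ∘ μ') * P'ᵀ := by
  have h := LinearMap.congr_fun (schurMultiplier_eq hA hA' hA hA' fun a _ => φ a) 1
  simp only [schurMultiplier_apply, Matrix.mul_one, hA.transpose_mul, hA'.transpose_mul,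
    Matrix.hadamard_one] at h
  exact h

end SchurMultiplier

section SpectralTheorem

variable {n ι : Type*} [Fintype n] [DecidableEq n] [Fintype ι] [DecidableEq ι]
  {A : Matrix n n ℝ} {P : Matrix n ι ℝ} {μ : ι → ℝ}

theorem isOrthDiag_eigenvectorUnitary (hA : A.IsHermitian) :
    IsOrthDiag A hA.eigenvectorUnitary.val hA.eigenvalues := by
  have hU := Unitary.coe_star_mul_self hA.eigenvectorUnitary
  have hspec := hA.spectral_theorem
  rw [Unitary.conjStarAlgAut_apply] at hspec
  rw [Matrix.star_eq_conjTranspose, Matrix.conjTranspose_eq_transpose_of_trivial] at hU hspec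
  exact ⟨hU, mul_eq_one_comm.mp hU, hspec⟩

theorem IsOrthDiag.isHermitian (h : IsOrthDiag A P μ) : A.IsHermitian := by
  rw [Matrix.IsHermitian, Matrix.conjTranspose_eq_transpose_of_trivial, h.eq]
  simp only [Matrix.transpose_mul, Matrix.transpose_transpose, Matrix.diagonal_transpose,
    Matrix.mul_assoc]

theorem IsOrthDiag.cfc (h : IsOrthDiag A P μ) (φ : ℝ → ℝ) :
    IsOrthDiag (cfc φ A) P (φ ∘ μ) := by
  refine ⟨h.transpose_mul, h.mul_transpose, ?_⟩
  have hA := h.isHermitian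
  rw [← (isOrthDiag_eigenvectorUnitary hA).mul_diagonal_comp_mul_transpose_eq h φ, hA.cfc_eq,
    Matrix.IsHermitian.cfc, Unitary.conjStarAlgAut_apply, Matrix.star_eq_conjTranspose,
    Matrix.conjTranspose_eq_transpose_of_trivial]
  rfl

end SpectralTheorem

instance instCompactSpaceUnitaryGroup {n 𝕜 : Type*} [Fintype n] [DecidableEq n] [RCLike 𝕜] :
    CompactSpace (Matrix.unitaryGroup n 𝕜) := by
  have hbox : IsCompact (Set.univ.pi fun _ => Set.univ.pi fun _ => Metric.closedBall 0 1 :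
      Set (n → n → 𝕜)) :=
    isCompact_univ_pi fun _ => isCompact_univ_pi fun _ => isCompact_closedBall 0 1
  have hclosed : IsClosed (Matrix.unitaryGroup n 𝕜 : Set (Matrix n n 𝕜)) := isClosed_unitary
  exact isCompact_iff_compactSpace.mp <| hbox.of_isClosed_subset hclosed fun U hU i _ j _ =>
    mem_closedBall_zero_iff.mpr (entry_norm_bound_of_unitary hU i j)

/-! ### Spectral functions on `𝕊ᵈ` and their slope operators -/

namespace SymMat

variable {d : ℕ}

/-- The spectral function `X ↦ P diag(φ(λ₁), …, φ(λ_d)) Pᵀ` on `𝕊ᵈ` attached to a scalar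
function `φ`, for `X = P diag(λ₁, …, λ_d) Pᵀ`. -/
noncomputable def cfc (φ : ℝ → ℝ) (X : SymMat d) : SymMat d :=
  ofSymm (_root_.cfc φ X.mat) (by
    have h := cfc_predicate φ X.mat
    rwa [IsSelfAdjoint, Matrix.star_eq_conjTranspose,
      Matrix.conjTranspose_eq_transpose_of_trivial] at h)

theorem mat_cfc (φ : ℝ → ℝ) (X : SymMat d) : (X.cfc φ).mat = _root_.cfc φ X.mat := rfl

theorem isOrthDiag (X : SymMat d) :
    IsOrthDiag X.mat X.isHermitian.eigenvectorUnitary.val X.isHermitian.eigenvalues :=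
  isOrthDiag_eigenvectorUnitary X.isHermitian

/-- The symmetric part `½(A + Aᵀ)`, used only as a linear left inverse of `SymMat.mat`. -/
noncomputable def symPart : Matrix (Fin d) (Fin d) ℝ →ₗ[ℝ] SymMat d :=
  LinearMap.codRestrict (symSubmodule d)
    ((1 / 2 : ℝ) • (LinearMap.id + (Matrix.transposeLinearEquiv (Fin d) (Fin d) ℝ ℝ).toLinearMap))
    fun A => by simp [symSubmodule, Matrix.IsSymm, add_comm]

theorem mat_symPart {A : Matrix (Fin d) (Fin d) ℝ} (hA : A.IsSymm) : (symPart A).mat = A := by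
  change (1 / 2 : ℝ) • (A + Aᵀ) = A
  rw [hA.eq, ← two_smul ℝ A, smul_smul]
  norm_num

theorem symPart_mat (X : SymMat d) : symPart X.mat = X :=
  SymMat.ext (mat_symPart X.isSymm)

/-- The Schur multiplier with symbol `Φ` in eigenbases of `X` and `Y`, as an operator on `𝕊ᵈ`.
For `X ≠ Y` a Schur multiplier does not preserve symmetry, so its symmetric part is taken. -/
noncomputable def schurOp (Φ : ℝ → ℝ → ℝ) (X Y : SymMat d) : SymMat d →L[ℝ] SymMat d :=
  LinearMap.toContinuousLinearMap <|
    symPart ∘ₗ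
      schurMultiplier Φ X.isHermitian.eigenvectorUnitary.val X.isHermitian.eigenvalues
        Y.isHermitian.eigenvectorUnitary.val Y.isHermitian.eigenvalues ∘ₗ mat

section

variable {ι κ : Type*} [Fintype ι] [DecidableEq ι] [Fintype κ] [DecidableEq κ] {X Y : SymMat d}
  {P : Matrix (Fin d) ι ℝ} {μ : ι → ℝ} {Q : Matrix (Fin d) κ ℝ} {ν : κ → ℝ}

theorem schurOp_apply (hX : IsOrthDiag X.mat P μ) (hY : IsOrthDiag Y.mat Q ν) (Φ : ℝ → ℝ → ℝ)
    (H : SymMat d) : schurOp Φ X Y H = symPart (schurMultiplier Φ P μ Q ν H.mat) := by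
  rw [← schurMultiplier_eq X.isOrthDiag hX Y.isOrthDiag hY]
  rfl

theorem mat_schurOp_self (hX : IsOrthDiag X.mat P μ) {Φ : ℝ → ℝ → ℝ} (hΦ : flip Φ = Φ)
    (H : SymMat d) : (schurOp Φ X X H).mat = schurMultiplier Φ P μ P μ H.mat := by
  rw [schurOp_apply hX hX, mat_symPart]
  rw [Matrix.IsSymm, transpose_schurMultiplier, hΦ, H.isSymm.eq]

end

theorem cfc_sub_cfc (φ : ℝ → ℝ) (X Y : SymMat d) :
    Y.cfc φ - X.cfc φ = schurOp (dslope φ) X Y (Y - X) := by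
  have hslope (a b : ℝ) : dslope φ a b * (a - b) = φ a - φ b := by
    rw [dslope_comm, mul_comm, ← smul_eq_mul, sub_smul_dslope]
  have hX := X.isOrthDiag
  have hY := Y.isOrthDiag
  have h := schurMultiplier_commutator hslope hX hY (hX.cfc φ) (hY.cfc φ) 1
  simp only [Matrix.mul_one, Matrix.one_mul] at h
  rw [schurOp_apply hX hY, ← neg_sub X Y, map_neg, map_neg, map_neg, map_sub mat, h, ← mat_cfc,
    ← mat_cfc, ← map_sub, symPart_mat, neg_sub]

/-- The symmetric matrix with given orthonormal eigenvectors and eigenvalues. -/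
def ofEigen (p : Matrix.unitaryGroup (Fin d) ℝ × (Fin d → ℝ)) : SymMat d :=
  ofSymm (p.1.val * Matrix.diagonal p.2 * p.1.valᵀ) (isSymm_mul_diagonal_mul_transpose _ _)

theorem isOrthDiag_ofEigen (p : Matrix.unitaryGroup (Fin d) ℝ × (Fin d → ℝ)) :
    IsOrthDiag (ofEigen p).mat p.1.val p.2 := by
  have hP := Matrix.mem_unitaryGroup_iff'.mp p.1.2
  rw [Matrix.star_eq_conjTranspose, Matrix.conjTranspose_eq_transpose_of_trivial] at hP
  exact ⟨hP, mul_eq_one_comm.mp hP, rfl⟩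

theorem surjective_ofEigen : Function.Surjective (ofEigen (d := d)) := fun X =>
  ⟨(X.isHermitian.eigenvectorUnitary, X.isHermitian.eigenvalues), SymMat.ext X.isOrthDiag.eq.symm⟩

theorem continuous_mat : Continuous (mat (d := d)) := mat.continuous_of_finiteDimensional

theorem continuous_ofEigen : Continuous (ofEigen (d := d)) := by
  have h : (ofEigen (d := d)) = fun p => symPart (p.1.val * Matrix.diagonal p.2 * p.1.valᵀ) :=
    funext fun p => (symPart_mat (ofEigen p)).symm
  rw [h]
  exact (symPart (d := d)).continuous_of_finiteDimensional.comp (by fun_prop)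

/-- The eigenvalues depend continuously on the eigenvectors and the matrix, so `(P, μ) ↦ (P, X)` is
a closed embedding; the projection to `X` is proper because the orthogonal group is compact. -/
theorem isProperMap_ofEigen : IsProperMap (ofEigen (d := d)) := by
  let e : Matrix.unitaryGroup (Fin d) ℝ × (Fin d → ℝ) →
    Matrix.unitaryGroup (Fin d) ℝ × SymMat d := fun p => (p.1, ofEigen p)
  have he : Topology.IsClosedEmbedding e := by
    have hcont : Continuous fun q : Matrix.unitaryGroup (Fin d) ℝ × SymMat d =>
        (q.1, (q.1.valᵀ * q.2.mat * q.1.val).diag) := by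
      have := continuous_mat (d := d)
      fun_prop
    refine Function.LeftInverse.isClosedEmbedding (fun p => Prod.ext rfl ?_) hcont
      (continuous_fst.prodMk continuous_ofEigen)
    exact (congrArg Matrix.diag (isOrthDiag_ofEigen p).transpose_mul_mul).trans
      (Matrix.diag_diagonal p.2)
  exact isProperMap_snd_of_compactSpace.comp he.isProperMap

theorem isQuotientMap_ofEigen_prodMap :
    Topology.IsQuotientMap (Prod.map (ofEigen (d := d)) (ofEigen (d := d))) :=
  (isProperMap_ofEigen.prodMap isProperMap_ofEigen).isClosedMap.isQuotientMap
    (continuous_ofEigen.prodMap continuous_ofEigen)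
    (surjective_ofEigen.prodMap surjective_ofEigen)

theorem continuous_schurOp {Φ : ℝ → ℝ → ℝ} (hΦ : Continuous fun p : ℝ × ℝ => Φ p.1 p.2) :
    Continuous fun p : SymMat d × SymMat d => schurOp Φ p.1 p.2 := by
  rw [isQuotientMap_ofEigen_prodMap.continuous_iff, continuous_clm_apply]
  intro H
  simp only [Function.comp_def, Prod.map_fst, Prod.map_snd,
    schurOp_apply (isOrthDiag_ofEigen _) (isOrthDiag_ofEigen _)]
  have hP : Continuous fun p : Matrix.unitaryGroup (Fin d) ℝ × (Fin d → ℝ) => p.1.val := by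
    fun_prop
  exact (symPart (d := d)).continuous_of_finiteDimensional.comp <|
    continuous_schurMultiplier hΦ (hP.comp continuous_fst) (continuous_snd.comp continuous_fst)
      (hP.comp continuous_snd) (continuous_snd.comp continuous_snd) H.mat

theorem continuous_schurOp_dslope {φ : ℝ → ℝ} (hφ : ContDiff ℝ 1 φ) :
    Continuous fun p : SymMat d × SymMat d => schurOp (dslope φ) p.1 p.2 :=
  continuous_schurOp (continuous_dslope_uncurry hφ)

theorem hasFDerivAt_cfc {φ : ℝ → ℝ} (hφ : ContDiff ℝ 1 φ) (X : SymMat d) :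
    HasFDerivAt (cfc φ) (schurOp (dslope φ) X X) X :=
  hasFDerivAt_of_slope (T := schurOp (dslope φ) X)
    ((continuous_schurOp_dslope hφ).comp (.prodMk_right X)).continuousAt (cfc_sub_cfc φ X)

theorem fderiv_cfc {φ : ℝ → ℝ} (hφ : ContDiff ℝ 1 φ) (X : SymMat d) :
    fderiv ℝ (cfc φ) X = schurOp (dslope φ) X X :=
  (hasFDerivAt_cfc hφ X).fderiv

theorem contDiff_one_cfc {φ : ℝ → ℝ} (hφ : ContDiff ℝ 1 φ) :
    ContDiff ℝ 1 (cfc φ : SymMat d → SymMat d) := by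
  have hcont : Continuous fun X : SymMat d => schurOp (dslope φ) X X :=
    (continuous_schurOp_dslope hφ).comp₂ continuous_id continuous_id
  exact contDiff_one_iff_hasFDerivAt.mpr ⟨_, hcont, hasFDerivAt_cfc hφ⟩

theorem mat_fderiv_cfc_apply {ι : Type*} [Fintype ι] [DecidableEq ι] {φ : ℝ → ℝ}
    (hφ : ContDiff ℝ 1 φ) {X : SymMat d} {P : Matrix (Fin d) ι ℝ} {μ : ι → ℝ}
    (hX : IsOrthDiag X.mat P μ) (H : SymMat d) :
    (fderiv ℝ (cfc φ) X H).mat =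
      P * (Matrix.of (fun i j => dslope φ (μ i) (μ j)) ⊙ (Pᵀ * H.mat * P)) * Pᵀ := by
  rw [fderiv_cfc hφ, mat_schurOp_self hX (Φ := dslope φ) (funext₂ fun a b => dslope_comm φ b a),
    schurMultiplier_apply]

theorem isOrthDiag_zero : IsOrthDiag (0 : SymMat d).mat (1 : Matrix (Fin d) (Fin d) ℝ) 0 :=
  ⟨by simp, by simp, by simp⟩

theorem fderiv_cfc_zero {φ : ℝ → ℝ} (hφ : ContDiff ℝ 1 φ) :
    fderiv ℝ (cfc φ) (0 : SymMat d) = deriv φ 0 • ContinuousLinearMap.id ℝ (SymMat d) := by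
  ext H i j
  rw [mat_fderiv_cfc_apply hφ isOrthDiag_zero]
  simp

/-! ### The trace of a spectral function -/

theorem inner_cfc_left {ι : Type*} [Fintype ι] [DecidableEq ι] {X : SymMat d}
    {P : Matrix (Fin d) ι ℝ} {μ : ι → ℝ} (hX : IsOrthDiag X.mat P μ) (φ : ℝ → ℝ)
    (H : SymMat d) : inner ℝ (X.cfc φ) H = ∑ i, φ (μ i) * (Pᵀ * H.mat * P) i i := by
  calc inner ℝ (X.cfc φ) H
      = (P * Matrix.diagonal (φ ∘ μ) * Pᵀ * H.mat).trace := by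
        rw [inner_def, (X.cfc φ).isSymm.eq, mat_cfc, (hX.cfc φ).eq]
    _ = (Matrix.diagonal (φ ∘ μ) * (Pᵀ * H.mat * P)).trace := by
        rw [Matrix.mul_assoc, Matrix.mul_assoc, Matrix.trace_mul_comm]
        simp only [Matrix.mul_assoc]
    _ = ∑ i, φ (μ i) * (Pᵀ * H.mat * P) i i := by
        simp only [Matrix.trace, Matrix.diag_apply, Matrix.diagonal_mul, Function.comp_apply]

theorem trace_mat_fderiv_cfc_apply {φ : ℝ → ℝ} (hφ : ContDiff ℝ 1 φ) (X H : SymMat d) :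
    (fderiv ℝ (cfc φ) X H).mat.trace = inner ℝ (X.cfc (deriv φ)) H := by
  have hX := X.isOrthDiag
  rw [mat_fderiv_cfc_apply hφ hX, inner_cfc_left hX, Matrix.trace_mul_comm, ← Matrix.mul_assoc,
    hX.transpose_mul, Matrix.one_mul]
  simp only [Matrix.trace, Matrix.diag_apply, Matrix.hadamard_apply, Matrix.of_apply, dslope_same]

/-- The linear functional `X ↦ tr X` on `𝕊ᵈ`. -/
noncomputable def traceCLM : SymMat d →L[ℝ] ℝ :=
  LinearMap.toContinuousLinearMap (Matrix.traceLinearMap (Fin d) ℝ ℝ ∘ₗ mat)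

theorem hasGradientAt_trace_cfc {φ : ℝ → ℝ} (hφ : ContDiff ℝ 1 φ) (X : SymMat d) :
    HasGradientAt (fun X : SymMat d => (X.cfc φ).mat.trace) (X.cfc (deriv φ)) X := by
  have hcfc : DifferentiableAt ℝ (cfc φ) X := (hasFDerivAt_cfc hφ X).differentiableAt
  rw [hasGradientAt_iff_hasFDerivAt]
  refine (traceCLM.hasFDerivAt.comp X hcfc.hasFDerivAt).congr_fderiv ?_
  exact ContinuousLinearMap.ext fun H => trace_mat_fderiv_cfc_apply hφ X H

end SymMat

/-! ### Gradients and Hessians of compositions -/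

section Composition

variable {E F : Type*} [NormedAddCommGroup E] [InnerProductSpace ℝ E] [CompleteSpace E]

theorem contDiff_succ_of_hasGradientAt {ψ : E → ℝ} {q : E → E} {k : ℕ}
    (hψ : ∀ y, HasGradientAt ψ (q y) y) (hq : ContDiff ℝ k q) : ContDiff ℝ (k + 1) ψ := by
  refine contDiff_succ_iff_hasFDerivAt.mpr ⟨fun y => InnerProductSpace.toDual ℝ E (q y), ?_,
    fun y => (hψ y).hasFDerivAt⟩
  exact (InnerProductSpace.toDual ℝ E).toContinuousLinearEquiv.contDiff.comp hq

theorem inner_fderiv_comm_of_hasGradientAt {ψ : E → ℝ} {q : E → E} {y : E}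
    (hψ : ∀ z, HasGradientAt ψ (q z) z) (hq : DifferentiableAt ℝ q y) (h k : E) :
    inner ℝ (fderiv ℝ q y h) k = inner ℝ h (fderiv ℝ q y k) := by
  have hdual : HasFDerivAt (fun z => InnerProductSpace.toDual ℝ E (q z)) _ y :=
    (InnerProductSpace.toDual ℝ E).toContinuousLinearEquiv.hasFDerivAt.comp y hq.hasFDerivAt
  rw [real_inner_comm (fderiv ℝ q y k)]
  exact second_derivative_symmetric (fun z => (hψ z).hasFDerivAt) hdual h k

theorem hasGradientAt_half_norm_sq (x : E) : HasGradientAt (fun y : E => ‖y‖ ^ 2 / 2) x x := by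
  rw [hasGradientAt_iff_hasFDerivAt]
  simp only [div_eq_inv_mul]
  refine ((hasStrictFDerivAt_norm_sq x).hasFDerivAt.const_mul (2⁻¹ : ℝ)).congr_fderiv ?_
  ext h
  simp

variable [NormedAddCommGroup F] [InnerProductSpace ℝ F] [CompleteSpace F]

theorem hasGradientAt_add {φ ψ : E → ℝ} {g h x : E} (hφ : HasGradientAt φ g x)
    (hψ : HasGradientAt ψ h x) : HasGradientAt (fun y => φ y + ψ y) (g + h) x := by
  rw [hasGradientAt_iff_hasFDerivAt, map_add]
  exact hφ.hasFDerivAt.add hψ.hasFDerivAt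

theorem hasGradientAt_const_mul {φ : E → ℝ} {g x : E} (hφ : HasGradientAt φ g x) (c : ℝ) :
    HasGradientAt (fun y => c * φ y) (c • g) x := by
  rw [hasGradientAt_iff_hasFDerivAt, map_smul]
  exact hφ.hasFDerivAt.const_mul c

theorem hasGradientAt_comp {ψ : E → ℝ} {g : E} {u : F → E} {x : F}
    (hψ : HasGradientAt ψ g (u x)) (hu : DifferentiableAt ℝ u x) :
    HasGradientAt (fun y => ψ (u y)) (ContinuousLinearMap.adjoint (fderiv ℝ u x) g) x := by
  rw [hasGradientAt_iff_hasFDerivAt]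
  refine (hψ.hasFDerivAt.comp x hu.hasFDerivAt).congr_fderiv (ContinuousLinearMap.ext fun h => ?_)
  exact (ContinuousLinearMap.adjoint_inner_left (fderiv ℝ u x) h g).symm

theorem hasGradientAt_comp_const_sub {ψ : E → ℝ} {g w : E} {u : F → E} {x : F}
    (hψ : HasGradientAt ψ g (w - u x)) (hu : DifferentiableAt ℝ u x) :
    HasGradientAt (fun y => ψ (w - u y)) (-ContinuousLinearMap.adjoint (fderiv ℝ u x) g) x := by
  have h := hasGradientAt_comp (u := fun y => w - u y) hψ (hu.const_sub w)
  rwa [fderiv_const_sub, map_neg] at h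

end Composition

section PartialDeriv

variable {n : ℕ} {Y : Type*} [NormedAddCommGroup Y] [NormedSpace ℝ Y]
  {φ : EuclideanSpace ℝ (Fin n) → Y} {x : EuclideanSpace ℝ (Fin n)}

theorem partialDeriv_eq_fderiv (h : DifferentiableAt ℝ φ x) (i : Fin n) :
    partialDeriv i φ x = fderiv ℝ φ x (EuclideanSpace.single i 1) :=
  h.lineDeriv_eq_fderiv

theorem partialDeriv_eq_of_hasFDerivAt {φ' : EuclideanSpace ℝ (Fin n) →L[ℝ] Y}
    (h : HasFDerivAt φ φ' x) (i : Fin n) :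
    partialDeriv i φ x = φ' (EuclideanSpace.single i 1) :=
  (partialDeriv_eq_fderiv h.differentiableAt i).trans (by rw [h.fderiv])

theorem differentiable_partialDeriv (h : ContDiff ℝ 2 φ) (i : Fin n) :
    Differentiable ℝ (partialDeriv i φ) := by
  rw [funext fun x => partialDeriv_eq_fderiv ((h.differentiable two_ne_zero) x) i]
  have := (h.fderiv_right (m := 1) (by norm_num)).differentiable one_ne_zero
  fun_prop

theorem gradient_apply {ψ : EuclideanSpace ℝ (Fin n) → ℝ} (h : DifferentiableAt ℝ ψ x)
    (i : Fin n) : gradient ψ x i = partialDeriv i ψ x := by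
  rw [partialDeriv_eq_fderiv h, ← inner_gradient_left, EuclideanSpace.inner_single_right]
  simp

theorem partialDeriv_add {χ : EuclideanSpace ℝ (Fin n) → Y} (hφ : DifferentiableAt ℝ φ x)
    (hχ : DifferentiableAt ℝ χ x) (i : Fin n) :
    partialDeriv i (fun y => φ y + χ y) x = partialDeriv i φ x + partialDeriv i χ x := by
  rw [partialDeriv_eq_of_hasFDerivAt (hφ.hasFDerivAt.fun_add hχ.hasFDerivAt),
    partialDeriv_eq_fderiv hφ, partialDeriv_eq_fderiv hχ]
  rfl

theorem partialDeriv_const_smul (hφ : DifferentiableAt ℝ φ x) (c : ℝ) (i : Fin n) :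
    partialDeriv i (fun y => c • φ y) x = c • partialDeriv i φ x := by
  rw [partialDeriv_eq_of_hasFDerivAt (hφ.hasFDerivAt.fun_const_smul c), partialDeriv_eq_fderiv hφ]
  rfl

theorem partialDeriv_const_sub (hφ : DifferentiableAt ℝ φ x) (c : Y) (i : Fin n) :
    partialDeriv i (fun y => c - φ y) x = -partialDeriv i φ x := by
  rw [partialDeriv_eq_of_hasFDerivAt (hφ.hasFDerivAt.const_sub c), partialDeriv_eq_fderiv hφ]
  rfl

theorem partialDeriv_neg (hφ : DifferentiableAt ℝ φ x) (i : Fin n) :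
    partialDeriv i (fun y => -φ y) x = -partialDeriv i φ x := by
  simpa only [zero_sub] using partialDeriv_const_sub hφ 0 i

theorem hessian_add {φ χ : EuclideanSpace ℝ (Fin n) → ℝ} (hφ : ContDiff ℝ 2 φ)
    (hχ : ContDiff ℝ 2 χ) (x : EuclideanSpace ℝ (Fin n)) :
    hessian (fun y => φ y + χ y) x = hessian φ x + hessian χ x := by
  ext i j
  have h : partialDeriv j (fun y => φ y + χ y) = fun y => partialDeriv j φ y + partialDeriv j χ y :=
    funext fun y => partialDeriv_add (hφ.differentiable two_ne_zero y)
      (hχ.differentiable two_ne_zero y) j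
  simp only [hessian, Matrix.of_apply, Matrix.add_apply, h]
  exact partialDeriv_add (differentiable_partialDeriv hφ j x) (differentiable_partialDeriv hχ j x) i

theorem hessian_const_mul {φ : EuclideanSpace ℝ (Fin n) → ℝ} (hφ : ContDiff ℝ 2 φ) (c : ℝ)
    (x : EuclideanSpace ℝ (Fin n)) : hessian (fun y => c * φ y) x = c • hessian φ x := by
  ext i j
  have h : partialDeriv j (fun y => c * φ y) = fun y => c • partialDeriv j φ y :=
    funext fun y => partialDeriv_const_smul (hφ.differentiable two_ne_zero y) c j
  simp only [hessian, Matrix.of_apply, Matrix.smul_apply, h]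
  exact partialDeriv_const_smul (differentiable_partialDeriv hφ j x) c i

variable {E : Type*} [NormedAddCommGroup E] [InnerProductSpace ℝ E] [CompleteSpace E]
  {ψ : E → ℝ} {q : E → E} {u : EuclideanSpace ℝ (Fin n) → E}

theorem hessian_comp_apply (hψ : ∀ y, HasGradientAt ψ (q y) y) (hq : Differentiable ℝ q)
    (hu : ContDiff ℝ 2 u) (x : EuclideanSpace ℝ (Fin n)) (i j : Fin n) :
    hessian (fun y => ψ (u y)) x i j =
      inner ℝ (partialDeriv i (partialDeriv j u) x) (q (u x)) +
        inner ℝ (partialDeriv i u x) (fderiv ℝ q (u x) (partialDeriv j u x)) := by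
  have hu' : Differentiable ℝ u := hu.differentiable two_ne_zero
  have hgrad : partialDeriv j (fun y => ψ (u y)) =
      fun y => inner ℝ (q (u y)) (partialDeriv j u y) := by
    funext y
    have hψu : HasFDerivAt (fun y => ψ (u y)) _ y :=
      (hψ (u y)).hasFDerivAt.comp y (hu' y).hasFDerivAt
    rw [partialDeriv_eq_of_hasFDerivAt hψu, partialDeriv_eq_fderiv (hu' y)]
    rfl
  have hqu : HasFDerivAt (fun y => q (u y)) _ x := (hq (u x)).hasFDerivAt.comp x (hu' x).hasFDerivAt
  have hju := differentiable_partialDeriv hu j x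
  rw [hessian, Matrix.of_apply, hgrad,
    partialDeriv_eq_of_hasFDerivAt (hqu.inner ℝ hju.hasFDerivAt), partialDeriv_eq_fderiv hju,
    partialDeriv_eq_fderiv (hu' x) i, ← inner_fderiv_comm_of_hasGradientAt hψ (hq _),
    real_inner_comm (q (u x))]
  rfl

theorem hessian_comp_const_sub_apply (hψ : ∀ y, HasGradientAt ψ (q y) y)
    (hq : Differentiable ℝ q) (hu : ContDiff ℝ 2 u) (w : E) (x : EuclideanSpace ℝ (Fin n))
    (i j : Fin n) :
    hessian (fun y => ψ (w - u y)) x i j =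
      -inner ℝ (partialDeriv i (partialDeriv j u) x) (q (w - u x)) +
        inner ℝ (partialDeriv i u x) (fderiv ℝ q (w - u x) (partialDeriv j u x)) := by
  have hsub (k : Fin n) : partialDeriv k (fun y => w - u y) = fun y => -partialDeriv k u y :=
    funext fun y => partialDeriv_const_sub (hu.differentiable two_ne_zero y) w k
  rw [hessian_comp_apply hψ hq (contDiff_const.sub hu), hsub, hsub,
    partialDeriv_neg (differentiable_partialDeriv hu j x), inner_neg_left, inner_neg_left, map_neg,
    inner_neg_right, neg_neg]

end PartialDeriv

section GradMatrix

variable {n m : ℕ} {g : EuclideanSpace ℝ (Fin n) → EuclideanSpace ℝ (Fin m)}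
  {x : EuclideanSpace ℝ (Fin n)}

theorem partialDeriv_component (hg : DifferentiableAt ℝ g x) (i : Fin n) (k : Fin m) :
    partialDeriv i (fun y => g y k) x = partialDeriv i g x k := by
  have hgk : HasFDerivAt (fun y => g y k) _ x :=
    (EuclideanSpace.proj k : EuclideanSpace ℝ (Fin m) →L[ℝ] ℝ).hasFDerivAt.comp x hg.hasFDerivAt
  rw [partialDeriv_eq_of_hasFDerivAt hgk, partialDeriv_eq_fderiv hg]
  rfl

theorem hessian_component_apply (hg : ContDiff ℝ 2 g) (x : EuclideanSpace ℝ (Fin n)) (i j : Fin n)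
    (k : Fin m) :
    hessian (fun y => g y k) x i j = partialDeriv i (partialDeriv j g) x k := by
  have h : partialDeriv j (fun y => g y k) = fun y => partialDeriv j g y k :=
    funext fun y => partialDeriv_component (hg.differentiable two_ne_zero y) j k
  rw [hessian, Matrix.of_apply, h, partialDeriv_component (differentiable_partialDeriv hg j x)]

theorem gradMatrix_apply (hg : DifferentiableAt ℝ g x) (i : Fin n) (k : Fin m) :
    gradMatrix g x i k = partialDeriv i g x k := by
  have hgk : DifferentiableAt ℝ (fun y => g y k) x := by fun_prop
  rw [gradMatrix, Matrix.of_apply, gradient_apply hgk, partialDeriv_component hg]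

theorem gradMatrix_mul_transpose_apply (hg : DifferentiableAt ℝ g x) (i j : Fin n) :
    (gradMatrix g x * (gradMatrix g x)ᵀ) i j =
      inner ℝ (partialDeriv i g x) (partialDeriv j g x) := by
  simp only [Matrix.mul_apply, Matrix.transpose_apply, gradMatrix_apply hg, PiLp.inner_apply,
    RCLike.inner_apply, conj_trivial, mul_comm]

theorem adjoint_fderiv_apply (hg : DifferentiableAt ℝ g x) (w : EuclideanSpace ℝ (Fin m)) :
    ContinuousLinearMap.adjoint (fderiv ℝ g x) w =
      WithLp.toLp 2 (gradMatrix g x *ᵥ WithLp.ofLp w) := by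
  ext i
  have hinner (z : EuclideanSpace ℝ (Fin n)) : z i = inner ℝ z (EuclideanSpace.single i 1) := by
    simp [EuclideanSpace.inner_single_right]
  rw [hinner, ContinuousLinearMap.adjoint_inner_left, ← partialDeriv_eq_fderiv hg,
    PiLp.inner_apply]
  simp only [Matrix.mulVec, dotProduct, gradMatrix_apply hg, RCLike.inner_apply, conj_trivial]

end GradMatrix

/-! ### The cube of the positive part -/

theorem hasDerivAt_max_zero_pow (k : ℕ) (t : ℝ) :
    HasDerivAt (fun s : ℝ => max s 0 ^ (k + 2)) ((k + 2) * max t 0 ^ (k + 1)) t := by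
  refine hasDerivAt_of_hasDerivAt_of_ne' (x := 0)
    (g := fun s : ℝ => (k + 2) * max s 0 ^ (k + 1)) (fun s hs => ?_) (by fun_prop) (by fun_prop) t
  obtain hs | hs := hs.lt_or_gt
  · have h : (fun r : ℝ => max r 0 ^ (k + 2)) =ᶠ[𝓝 s] fun _ => 0 := by
      filter_upwards [Iio_mem_nhds hs] with r hr
      rw [max_eq_right (Set.mem_Iio.mp hr).le, zero_pow (by lia)]
    simpa [max_eq_right hs.le] using (hasDerivAt_const s (0 : ℝ)).congr_of_eventuallyEq h
  · have h : (fun r : ℝ => max r 0 ^ (k + 2)) =ᶠ[𝓝 s] fun r => r ^ (k + 2) := by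
      filter_upwards [Ioi_mem_nhds hs] with r hr
      rw [max_eq_left (Set.mem_Ioi.mp hr).le]
    simpa [max_eq_left hs.le] using (hasDerivAt_pow (k + 2) s).congr_of_eventuallyEq h

theorem deriv_max_zero_pow (k : ℕ) :
    deriv (fun t : ℝ => max t 0 ^ (k + 2)) = fun t : ℝ => (k + 2) * max t 0 ^ (k + 1) :=
  funext fun t => (hasDerivAt_max_zero_pow k t).deriv

theorem contDiff_one_max_zero_pow (k : ℕ) : ContDiff ℝ 1 fun t : ℝ => max t 0 ^ (k + 2) := by
  rw [contDiff_one_iff_deriv, deriv_max_zero_pow]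
  exact ⟨fun t => (hasDerivAt_max_zero_pow k t).differentiableAt, by fun_prop⟩

theorem dslope_max_zero_cube {a b : ℝ} (h : a ≠ 0 ∨ b ≠ 0) :
    dslope (fun t : ℝ => max t 0 ^ 3) a b =
      ((|a| ^ 3 + a ^ 3 + |b| ^ 3 + b ^ 3) * (a ^ 2 + a * b + b ^ 2)) /
        (2 * (|a| ^ 3 + |b| ^ 3)) := by
  have hpos : 0 < |a| ^ 3 + |b| ^ 3 := by
    obtain h | h := h <;> positivity
  rw [eq_div_iff (by positivity)]
  obtain rfl | hab := eq_or_ne a b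
  · rw [dslope_same, deriv_max_zero_pow]
    obtain ha | ha := le_total a 0
    · simp only [max_eq_right ha, abs_of_nonpos ha]
      ring
    · simp only [max_eq_left ha, abs_of_nonneg ha]
      push_cast
      ring
  · refine mul_left_cancel₀ (sub_ne_zero.mpr hab.symm) ?_
    rw [← mul_assoc, ← smul_eq_mul (b - a), sub_smul_dslope]
    obtain ha | ha := le_total a 0 <;> obtain hb | hb := le_total b 0 <;>
      simp only [abs_of_nonpos, abs_of_nonneg, max_eq_left, max_eq_right, ha, hb] <;> ring

theorem dslope_max_zero_cube_zero_right (a : ℝ) :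
    dslope (fun t : ℝ => max t 0 ^ 3) a 0 = 1 / 2 * ((|a| + a) * a) := by
  obtain rfl | ha := eq_or_ne a 0
  · simp [deriv_max_zero_pow]
  · refine mul_left_cancel₀ (sub_ne_zero.mpr ha.symm) ?_
    rw [← smul_eq_mul (0 - a), sub_smul_dslope]
    obtain h | h := le_total a 0
    · simp [max_eq_right h, abs_of_nonpos h]
    · simp only [max_eq_left h, abs_of_nonneg h, max_self]
      ring

namespace SymMat

variable {d : ℕ}

theorem mat_posPart (X : SymMat d) : X.posPart.mat = _root_.cfc (fun t : ℝ => max t 0) X.mat := by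
  have hX := X.isOrthDiag
  exact (X.posPart_eq _ _ hX.transpose_mul hX.eq).trans (hX.cfc fun t => max t 0).eq.symm

theorem mat_posPart_pow (X : SymMat d) (k : ℕ) :
    X.posPart.mat ^ k = (X.cfc fun t => max t 0 ^ k).mat := by
  have hX : IsSelfAdjoint X.mat := X.isHermitian
  rw [mat_posPart, mat_cfc, cfc_pow (fun t : ℝ => max t 0) k X.mat]

theorem cubePosPart_eq_cfc : cubePosPart (d := d) = cfc fun t => max t 0 ^ 3 :=
  funext fun X => SymMat.ext (X.mat_posPart_pow 3)

end SymMat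

section CubePosPart

variable {d : ℕ}

theorem contDiff_one_cubePosPart : ContDiff ℝ 1 (cubePosPart (d := d)) := by
  rw [SymMat.cubePosPart_eq_cfc]
  exact SymMat.contDiff_one_cfc (contDiff_one_max_zero_pow 1)

theorem fderiv_cubePosPart_zero : fderiv ℝ (cubePosPart (d := d)) 0 = 0 := by
  have hderiv : deriv (fun t : ℝ => max t 0 ^ 3) 0 = 0 := by simp [deriv_max_zero_pow]
  rw [SymMat.cubePosPart_eq_cfc, SymMat.fderiv_cfc_zero (contDiff_one_max_zero_pow 1), hderiv]
  ext1 H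
  exact zero_smul ℝ H

theorem isOrthDiag_fromCols {R n ι κ : Type*} [CommRing R] [Fintype n] [DecidableEq n]
    [Fintype ι] [DecidableEq ι] [Fintype κ] [DecidableEq κ] {A : Matrix n n R}
    {P₁ : Matrix n ι R} {P₂ : Matrix n κ R} {μ : ι → R}
    (h : (Matrix.fromCols P₁ P₂)ᵀ * Matrix.fromCols P₁ P₂ = 1)
    (h' : Matrix.fromCols P₁ P₂ * (Matrix.fromCols P₁ P₂)ᵀ = 1)
    (hA : A = Matrix.fromCols P₁ P₂ *
      (Matrix.fromBlocks (Matrix.diagonal μ) 0 0 0 : Matrix (ι ⊕ κ) (ι ⊕ κ) R) *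
      Matrix.fromRows P₁ᵀ P₂ᵀ) :
    IsOrthDiag A (Matrix.fromCols P₁ P₂) (Sum.elim μ 0) := by
  refine ⟨h, h', ?_⟩
  rw [hA, Matrix.transpose_fromCols, ← Matrix.fromBlocks_diagonal, Matrix.diagonal_zero']

theorem mat_fderiv_cubePosPart_apply {l k : ℕ} {X : SymMat d} {P₁ : Matrix (Fin d) (Fin l) ℝ}
    {P₂ : Matrix (Fin d) (Fin k) ℝ} {μ : Fin l → ℝ} (hμ : ∀ j, μ j ≠ 0)
    (hX : IsOrthDiag X.mat (Matrix.fromCols P₁ P₂) (Sum.elim μ 0)) (H : SymMat d) :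
    (fderiv ℝ cubePosPart X H).mat =
      Matrix.fromCols P₁ P₂ *
        Matrix.fromBlocks
          (coeffA μ ⊙ (P₁ᵀ * H.mat * P₁))
          (coeffB μ * P₁ᵀ * H.mat * P₂)
          (P₂ᵀ * H.mat * P₁ * coeffB μ)
          0 *
        Matrix.fromRows P₁ᵀ P₂ᵀ := by
  have hB : coeffB μ = Matrix.diagonal fun i => 1 / 2 * ((|μ i| + μ i) * μ i) := by
    rw [coeffB, Matrix.diagonal_add, Matrix.diagonal_mul_diagonal, ← Matrix.diagonal_smul]
    rfl
  rw [SymMat.cubePosPart_eq_cfc, SymMat.mat_fderiv_cfc_apply (contDiff_one_max_zero_pow 1) hX,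
    Matrix.transpose_fromCols, Matrix.fromRows_mul, Matrix.fromRows_mul_fromCols, hB]
  congr 2
  ext (i | i) (j | j)
  · simp [coeffA, dslope_max_zero_cube (.inl (hμ i))]
  · simp [dslope_max_zero_cube_zero_right, Matrix.mul_assoc, Matrix.diagonal_mul]
  · simp [dslope_comm _ 0 (μ j), dslope_max_zero_cube_zero_right, Matrix.mul_diagonal, mul_comm]
  · simp [deriv_max_zero_pow]

theorem hasGradientAt_trace_posPart_pow_four (X : SymMat d) :
    HasGradientAt (fun X : SymMat d => (X.posPart.mat ^ 4).trace / 4) (cubePosPart X) X := by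
  have hderiv : deriv (fun t : ℝ => max t 0 ^ 4) = fun t => 4 * max t 0 ^ 3 := by
    rw [deriv_max_zero_pow]
    norm_num
  have hcfc : (4⁻¹ : ℝ) • X.cfc (fun t => 4 * max t 0 ^ 3) = cubePosPart X := by
    ext1
    rw [map_smul, SymMat.cubePosPart_eq_cfc, SymMat.mat_cfc, SymMat.mat_cfc,
      cfc_const_mul (4 : ℝ) (fun t => max t 0 ^ 3) X.mat, inv_smul_smul₀ four_ne_zero]
  simp only [SymMat.mat_posPart_pow, div_eq_inv_mul]
  rw [← hcfc, ← hderiv]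
  exact hasGradientAt_const_mul (SymMat.hasGradientAt_trace_cfc (contDiff_one_max_zero_pow 2) X) _

end CubePosPart

/-! ### The penalty function -/

section Penalty

variable {n m d : ℕ} {f : EuclideanSpace ℝ (Fin n) → ℝ}
  {g : EuclideanSpace ℝ (Fin n) → EuclideanSpace ℝ (Fin m)}
  {G : EuclideanSpace ℝ (Fin n) → SymMat d}

theorem penaltyF_eq (f : EuclideanSpace ℝ (Fin n) → ℝ)
    (g : EuclideanSpace ℝ (Fin n) → EuclideanSpace ℝ (Fin m))
    (G : EuclideanSpace ℝ (Fin n) → SymMat d) (v : EuclideanSpace ℝ (Fin m)) (M : SymMat d)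
    (ρ σ τ : ℝ) :
    penaltyF f g G v M ρ σ τ = fun x => ρ * f x + σ * τ * (‖(1 / τ) • v - g x‖ ^ 2 / 2) +
      σ * τ * ((((1 / τ) • M - G x).posPart.mat ^ 4).trace / 4) := by
  funext x
  rw [penaltyF]
  ring

theorem contDiff_half_norm_sq_const_sub (hg : ContDiff ℝ 2 g) (w : EuclideanSpace ℝ (Fin m)) :
    ContDiff ℝ 2 fun x => ‖w - g x‖ ^ 2 / 2 :=
  ((contDiff_const.sub hg).norm_sq ℝ).div_const 2

theorem contDiff_trace_posPart_pow_four_const_sub (hG : ContDiff ℝ 2 G) (N : SymMat d) :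
    ContDiff ℝ 2 fun x => ((N - G x).posPart.mat ^ 4).trace / 4 :=
  (contDiff_succ_of_hasGradientAt (k := 1) hasGradientAt_trace_posPart_pow_four
    contDiff_one_cubePosPart).comp (contDiff_const.sub hG)

theorem contDiff_penaltyF (hf : ContDiff ℝ 2 f) (hg : ContDiff ℝ 2 g) (hG : ContDiff ℝ 2 G)
    (v : EuclideanSpace ℝ (Fin m)) (M : SymMat d) (ρ σ τ : ℝ) :
    ContDiff ℝ 2 (penaltyF f g G v M ρ σ τ) := by
  rw [penaltyF_eq]
  exact ((contDiff_const.mul hf).add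
    (contDiff_const.mul (contDiff_half_norm_sq_const_sub hg _))).add
    (contDiff_const.mul (contDiff_trace_posPart_pow_four_const_sub hG _))

theorem hasGradientAt_penaltyF {x : EuclideanSpace ℝ (Fin n)} (hf : DifferentiableAt ℝ f x)
    (hg : DifferentiableAt ℝ g x) (hG : DifferentiableAt ℝ G x) (v : EuclideanSpace ℝ (Fin m))
    (M : SymMat d) (ρ σ τ : ℝ) :
    HasGradientAt (penaltyF f g G v M ρ σ τ)
      (ρ • gradient f x
        - (σ * τ) • WithLp.toLp 2 (gradMatrix g x *ᵥ WithLp.ofLp ((1 / τ) • v - g x))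
        - (σ * τ) • ContinuousLinearMap.adjoint (fderiv ℝ G x)
            (cubePosPart ((1 / τ) • M - G x))) x := by
  have hnorm := hasGradientAt_comp_const_sub (hasGradientAt_half_norm_sq ((1 / τ) • v - g x)) hg
  have htrace := hasGradientAt_comp_const_sub
    (hasGradientAt_trace_posPart_pow_four ((1 / τ) • M - G x)) hG
  rw [penaltyF_eq, ← adjoint_fderiv_apply hg, sub_eq_add_neg, sub_eq_add_neg, ← smul_neg,
    ← smul_neg]
  exact hasGradientAt_add (hasGradientAt_add (hasGradientAt_const_mul hf.hasGradientAt ρ)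
    (hasGradientAt_const_mul hnorm (σ * τ))) (hasGradientAt_const_mul htrace (σ * τ))

theorem hessian_half_norm_sq_const_sub (hg : ContDiff ℝ 2 g) (w : EuclideanSpace ℝ (Fin m))
    (x : EuclideanSpace ℝ (Fin n)) :
    hessian (fun y => ‖w - g y‖ ^ 2 / 2) x =
      -∑ k, (w k - g x k) • hessian (fun y => g y k) x +
        gradMatrix g x * (gradMatrix g x)ᵀ := by
  ext i j
  rw [hessian_comp_const_sub_apply (q := id) hasGradientAt_half_norm_sq differentiable_id hg,
    Matrix.add_apply, gradMatrix_mul_transpose_apply (hg.differentiable two_ne_zero x), fderiv_id,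
    Matrix.neg_apply, Matrix.sum_apply, PiLp.inner_apply]
  simp only [Matrix.smul_apply, hessian_component_apply hg, RCLike.inner_apply, conj_trivial,
    smul_eq_mul, id_eq, PiLp.sub_apply, ContinuousLinearMap.id_apply]

theorem hessian_trace_posPart_pow_four_const_sub (hG : ContDiff ℝ 2 G) (N : SymMat d)
    (x : EuclideanSpace ℝ (Fin n)) :
    hessian (fun y => ((N - G y).posPart.mat ^ 4).trace / 4) x =
      -Matrix.of (fun i j : Fin n =>
        inner ℝ (partialDeriv i (partialDeriv j G) x) (cubePosPart (N - G x))) +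
      Matrix.of (fun i j : Fin n =>
        inner ℝ (partialDeriv i G x) (fderiv ℝ cubePosPart (N - G x) (partialDeriv j G x))) := by
  ext i j
  exact hessian_comp_const_sub_apply hasGradientAt_trace_posPart_pow_four
    (contDiff_one_cubePosPart.differentiable one_ne_zero) hG N x i j

theorem hessian_penaltyF (hf : ContDiff ℝ 2 f) (hg : ContDiff ℝ 2 g) (hG : ContDiff ℝ 2 G)
    (v : EuclideanSpace ℝ (Fin m)) (M : SymMat d) (ρ σ τ : ℝ) (x : EuclideanSpace ℝ (Fin n)) :
    hessian (penaltyF f g G v M ρ σ τ) x =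
      ρ • hessian f x
        - (σ * τ) • ∑ j : Fin m, ((1 / τ) * v j - g x j) • hessian (fun y => g y j) x
        + (σ * τ) • (gradMatrix g x * (gradMatrix g x)ᵀ)
        - (σ * τ) • Matrix.of (fun i j : Fin n =>
            inner ℝ (partialDeriv i (partialDeriv j G) x) (cubePosPart ((1 / τ) • M - G x)))
        + (σ * τ) • Matrix.of (fun i j : Fin n =>
            inner ℝ (partialDeriv i G x)
              (fderiv ℝ cubePosPart ((1 / τ) • M - G x) (partialDeriv j G x))) := by
  have hnorm := contDiff_half_norm_sq_const_sub hg ((1 / τ) • v)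
  have htrace := contDiff_trace_posPart_pow_four_const_sub hG ((1 / τ) • M)
  rw [penaltyF_eq, hessian_add ((contDiff_const.mul hf).add (contDiff_const.mul hnorm))
    (contDiff_const.mul htrace), hessian_add (contDiff_const.mul hf) (contDiff_const.mul hnorm),
    hessian_const_mul hf, hessian_const_mul hnorm, hessian_const_mul htrace,
    hessian_half_norm_sq_const_sub hg, hessian_trace_posPart_pow_four_const_sub hG]
  simp only [PiLp.smul_apply, smul_eq_mul]
  module

end Penalty

theorem mainTheorem1 {n m d : ℕ}
    (f : EuclideanSpace ℝ (Fin n) → ℝ)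
    (g : EuclideanSpace ℝ (Fin n) → EuclideanSpace ℝ (Fin m))
    (G : EuclideanSpace ℝ (Fin n) → SymMat d)
    (hf : ContDiff ℝ 2 f) (hg : ContDiff ℝ 2 g) (hG : ContDiff ℝ 2 G)
    (v : EuclideanSpace ℝ (Fin m)) (M : SymMat d) (ρ σ τ : ℝ)
    (hρ : 0 < ρ) (hσ : 0 < σ) (hτ : 0 < τ) :
    -- the derivative of `𝒬`: existence, closed form, continuity
    (Differentiable ℝ (cubePosPart (d := d)) ∧
      fderiv ℝ (cubePosPart (d := d)) 0 = 0 ∧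
      (∀ (X : SymMat d) (l k : ℕ) (P₁ : Matrix (Fin d) (Fin l) ℝ) (P₂ : Matrix (Fin d) (Fin k) ℝ)
          (μ : Fin l → ℝ),
        X ≠ 0 →
        Matrix.fromCols P₁ P₂ * (Matrix.fromCols P₁ P₂)ᵀ = 1 →
        (Matrix.fromCols P₁ P₂)ᵀ * Matrix.fromCols P₁ P₂ = 1 →
        (∀ j, μ j ≠ 0) →
        X.mat =
          Matrix.fromCols P₁ P₂ * (Matrix.fromBlocks (Matrix.diagonal μ) 0 0 0 :
              Matrix (Fin l ⊕ Fin k) (Fin l ⊕ Fin k) ℝ) *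
            Matrix.fromRows P₁ᵀ P₂ᵀ →
        ∀ H : SymMat d,
          (fderiv ℝ cubePosPart X H).mat =
            Matrix.fromCols P₁ P₂ *
              Matrix.fromBlocks
                (coeffA μ ⊙ (P₁ᵀ * H.mat * P₁))
                (coeffB μ * P₁ᵀ * H.mat * P₂)
                (P₂ᵀ * H.mat * P₁ * coeffB μ)
                0 *
              Matrix.fromRows P₁ᵀ P₂ᵀ) ∧
      Continuous (fderiv ℝ (cubePosPart (d := d)))) ∧
    -- the penalty function: regularity, gradient, Hessian
    ContDiff ℝ 2 (penaltyF f g G v M ρ σ τ) ∧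
    (∀ x : EuclideanSpace ℝ (Fin n),
      HasGradientAt (penaltyF f g G v M ρ σ τ)
        (ρ • gradient f x
          - (σ * τ) • WithLp.toLp 2 (gradMatrix g x *ᵥ WithLp.ofLp ((1 / τ) • v - g x))
          - (σ * τ) • ContinuousLinearMap.adjoint (fderiv ℝ G x)
              (cubePosPart ((1 / τ) • M - G x))) x) ∧
    (∀ x : EuclideanSpace ℝ (Fin n),
      hessian (penaltyF f g G v M ρ σ τ) x =
        ρ • hessian f x
          - (σ * τ) • ∑ j : Fin m, ((1 / τ) * v j - g x j) • hessian (fun y => g y j) x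
          + (σ * τ) • (gradMatrix g x * (gradMatrix g x)ᵀ)
          - (σ * τ) • Matrix.of (fun i j : Fin n =>
              inner ℝ (partialDeriv i (partialDeriv j G) x) (cubePosPart ((1 / τ) • M - G x)))
          + (σ * τ) • Matrix.of (fun i j : Fin n =>
              inner ℝ (partialDeriv i G x)
                (fderiv ℝ cubePosPart ((1 / τ) • M - G x) (partialDeriv j G x)))) := by
  refine ⟨⟨contDiff_one_cubePosPart.differentiable one_ne_zero, fderiv_cubePosPart_zero, ?_,
    contDiff_one_cubePosPart.continuous_fderiv one_ne_zero⟩,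
    contDiff_penaltyF hf hg hG v M ρ σ τ, fun x => ?_, hessian_penaltyF hf hg hG v M ρ σ τ⟩
  · intro X l k P₁ P₂ μ _ h' h hμ hX
    exact mat_fderiv_cubePosPart_apply hμ (isOrthDiag_fromCols h h' hX)
  · exact hasGradientAt_penaltyF (hf.differentiable two_ne_zero x) (hg.differentiable two_ne_zero x)
      (hG.differentiable two_ne_zero x) v M ρ σ τ
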